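/- All vector spaces are over a field $\mathbf{k}$ of characteristic $0$, and gradings are by $\mathbb{Z}$. Let $L=\bigoplus_{i\in\mathbb{Z}}L_i$ be a graded Lie algebra with (degree $0$, graded skew-symmetric) bracket $[\,,]$, let $\mathfrak{a}\subset L$ be a graded abelian Lie subalgebra, and let $P:L\to L$ be a degree-preserving linear projection with $\operatorname{im}(P)=\mathfrak{a}$ whose kernel is a Lie subalgebra of $L$. A $V$-data $(L,\mathfrak{a},P,\triangle)$ consists of these together with an element $\triangle\in\ker(P)\cap L_1$ such that $[\triangle,\triangle]=0$. Its higher derived brackets on $\mathfrak a$ are $$\rho_k(a_1,\ldots,a_k)=P[\cdots[[\triangle,a_1],a_2],\ldots,a_k],\qquad k\ge 1.$$ Let $s\mathfrak{a}$ be the suspension, $(s\mathfrak{a})_i=\mathfrak{a}_{i-1}$, and put $l_k=s\circ\rho_k\circ(s^{-1})^{\otimes k}$ (with the Koszul sign rule), i.e. $l_k(x_1,\ldots,x_k)=(-1)^{\sum_{a=1}^k (k-a)|x_a|}\,s\rho_k(s^{-1}x_1,\ldots,s^{-1}x_k)$ for homogeneous $x_a\in s\mathfrak{a}$. An $L_\infty$-algebra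 $(W,\{l_k\}_{k\ge1})$ is a graded vector space $W$ with graded skew-symmetric multilinear maps $l_k:W^{\otimes k}\to W$ of degree $2-k$ such that for all $n\ge 1$ and homogeneous $x_1,\ldots,x_n\in W$ $$\sum_{i+j=n+1}\ \sum_{\sigma\in Sh(i,n-i)}\chi(\sigma)(-1)^{i(j-1)}\,l_j\big(l_i(x_{\sigma(1)},\ldots,x_{\sigma(i)}),x_{\sigma(i+1)},\ldots,x_{\sigma(n)}\big)=0,$$ where $i,j\ge1$, $Sh(i,n-i)$ is the set of $(i,n-i)$-shuffles, and $\chi(\sigma)$ is the sign of $\sigma$ times its Koszul sign. A compatible $L_\infty$-algebra $(W,\{l_k\},\{l'_k\})$ consists of two $L_\infty$-algebras $(W,\{l_k\})$ and $(W,\{l'_k\})$ on the same graded vector space such that for all $n\ge1$ and homogeneous $x_1,\ldots,x_n\in W$ $$\sum_{i+j=n+1}\ \sum_{\sigma\in Sh(i,n-i)}\chi(\sigma)(-1)^{i(j-1)}\Big\{l_j\big(l'_i(x_{\sigma(1)},\ldots,x_{\sigma(i)}),x_{\sigma(i+1)},\ldots,x_{\sigma(n)}\big)+l'_j\big(l_i(x_{\sigma(1)},\ldots,x_{\sigma(i)}),x_{\sigma(i+1)},\ldots,x_{\sigma(n)}\big)\Big\}=0.$$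 **Proposition.** Let $(L,\mathfrak{a},P,\triangle)$ and $(L,\mathfrak{a},P,\triangle')$ be two $V$-datas with $[\triangle,\triangle']=0$, and let $\{l_k\}_{k\ge1}$ and $\{l'_k\}_{k\ge1}$ be the corresponding maps on $s\mathfrak{a}$. Then $(s\mathfrak{a},\{l_k\}_{k\ge1})$ and $(s\mathfrak{a},\{l'_k\}_{k\ge1})$ are $L_\infty$-algebras, and $(s\mathfrak{a},\{l_k\}_{k\ge1},\{l'_k\}_{k\ge1})$ is a compatible $L_\infty$-algebra. -/

import Mathlib

open scoped DirectSum

/-! A `ℤ`-graded vector space is a module `V` with a family `𝒱 : ℤ → Submodule 𝕜 V` carrying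
`[DirectSum.Decomposition 𝒱]`, that is, `V = ⨁ i, 𝒱 i`. -/

section GradedSpaces

variable {𝕜 V : Type*} [Field 𝕜] [AddCommGroup V] [Module 𝕜 V]

/-- The suspension `sV` of a graded vector space: the same space, with `(sV)ᵢ = Vᵢ₋₁`.
The degree `1` map `s : V → sV` is the identity of the underlying space. -/
def suspension (𝒱 : ℤ → Submodule 𝕜 V) : ℤ → Submodule 𝕜 V := fun i => 𝒱 (i - 1)

theorem suspension_apply (𝒱 : ℤ → Submodule 𝕜 V) (i : ℤ) : suspension 𝒱 i = 𝒱 (i - 1) := rfl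

noncomputable instance suspension.decomposition (𝒱 : ℤ → Submodule 𝕜 V)
    [DirectSum.Decomposition 𝒱] : DirectSum.Decomposition (suspension 𝒱) :=
  DirectSum.Decomposition.ofLinearMap (suspension 𝒱)
    ((DirectSum.toModule 𝕜 ℤ (⨁ i, suspension 𝒱 i) fun i =>
        (DirectSum.lof 𝕜 ℤ (fun i => suspension 𝒱 i) (i + 1)).comp
          (Submodule.inclusion (by rw [suspension_apply, add_sub_cancel_right]))).comp
      (DirectSum.decomposeLinearEquiv 𝒱).toLinearMap)
    (by
      ext x
      induction x using DirectSum.Decomposition.inductionOn 𝒱 with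
      | zero => simp
      | homogeneous m =>
        simp [DirectSum.toModule_lof]
      | add a b ha hb => simp only [map_add, ha, hb])
    (by
      ext i x : 2
      obtain ⟨x, hx⟩ := x
      have hx' : x ∈ 𝒱 (i - 1) := hx
      simp only [LinearMap.comp_apply, DirectSum.coeLinearMap_lof, LinearMap.id_apply,
        LinearEquiv.coe_coe, DirectSum.decomposeLinearEquiv_apply,
        DirectSum.decompose_of_mem 𝒱 hx', ← DirectSum.lof_eq_of 𝕜, DirectSum.toModule_lof]
      have key : ∀ (j : ℤ) (_ : j = i) (h : x ∈ suspension 𝒱 j),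
          DirectSum.lof 𝕜 ℤ (fun i => suspension 𝒱 i) j ⟨x, h⟩
            = DirectSum.lof 𝕜 ℤ (fun i => suspension 𝒱 i) i ⟨x, hx⟩ := by
        rintro j rfl h
        rfl
      exact key _ (sub_add_cancel i 1) _)

/-- The involution of a graded vector space that acts on degree `i` by `(-1)ⁱ`. -/
noncomputable def degreeInvolution (𝒱 : ℤ → Submodule 𝕜 V) [DirectSum.Decomposition 𝒱] :
    V →ₗ[𝕜] V :=
  (DirectSum.toModule 𝕜 ℤ V fun i => (i.negOnePow : ℤ) • (𝒱 i).subtype).comp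
    (DirectSum.decomposeLinearEquiv 𝒱).toLinearMap

theorem degreeInvolution_of_mem (𝒱 : ℤ → Submodule 𝕜 V) [DirectSum.Decomposition 𝒱]
    {i : ℤ} {x : V} (hx : x ∈ 𝒱 i) : degreeInvolution 𝒱 x = i.negOnePow • x := by
  rw [degreeInvolution, LinearMap.comp_apply, LinearEquiv.coe_coe,
    DirectSum.decomposeLinearEquiv_apply, DirectSum.decompose_of_mem 𝒱 hx,
    ← DirectSum.lof_eq_of 𝕜, DirectSum.toModule_lof, LinearMap.smul_apply,
    Submodule.subtype_apply, Units.smul_def]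

/-- The Koszul sign `ε(σ; v₁, …, vₙ)` for elements of degrees `d₁, …, dₙ`, defined by
`v_{σ(1)} ⊙ ⋯ ⊙ v_{σ(n)} = ε(σ) v₁ ⊙ ⋯ ⊙ vₙ`: each pair of positions `a < b` that `σ` inverts
contributes `(-1)` to the power `d_{σ(a)} d_{σ(b)}`. -/
def koszulSign {n : ℕ} (σ : Equiv.Perm (Fin n)) (d : Fin n → ℤ) : ℤˣ :=
  ∏ p ∈ (Finset.univ : Finset (Fin n × Fin n)).filter (fun p => p.1 < p.2 ∧ σ p.2 < σ p.1),
    (d (σ p.1) * d (σ p.2)).negOnePow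

/-- The sign `χ(σ) = (-1)^σ ε(σ)`. -/
def skewKoszulSign {n : ℕ} (σ : Equiv.Perm (Fin n)) (d : Fin n → ℤ) : ℤˣ :=
  Equiv.Perm.sign σ * koszulSign σ d

/-- The set `Sh(i, n - i)` of `(i, n - i)`-shuffles in `Sₙ`: permutations that are increasing
on the first `i` positions and on the last `n - i` positions. -/
def shuffles (i n : ℕ) : Finset (Equiv.Perm (Fin n)) :=
  Finset.univ.filter fun σ =>
    (∀ a b : Fin n, a < b → b.val < i → σ a < σ b) ∧
    (∀ a b : Fin n, a < b → i ≤ a.val → σ a < σ b)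

/-- A family of multilinear maps `lₙ : V^{⊗ n} → V`. Only the members with `n ≥ 1` matter
below. -/
abbrev MultilinearFamily (𝕜 V : Type*) [Field 𝕜] [AddCommGroup V] [Module 𝕜 V] :=
  ∀ n : ℕ, MultilinearMap 𝕜 (fun _ : Fin n => V) V

/-- The sum
`∑_{i+j=n+1} ∑_{σ ∈ Sh(i,n-i)} χ(σ) (-1)^{i(j-1)} lⱼ(mᵢ(x_{σ(1)}, …, x_{σ(i)}), x_{σ(i+1)}, …, x_{σ(n)})`
with `i, j ≥ 1`, for elements `x₁, …, xₙ` of degrees `d₁, …, dₙ`. The summation index `p`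
corresponds to `i = p + 1` and `j = (n - (p + 1)) + 1`. -/
def higherJacobiSum (l m : MultilinearFamily 𝕜 V) (n : ℕ) (d : Fin n → ℤ) (x : Fin n → V) : V :=
  ∑ p : Fin n, ∑ σ ∈ shuffles (p.val + 1) n,
    (skewKoszulSign σ d * (-1) ^ ((p.val + 1) * (n - (p.val + 1)))) •
      l (n - (p.val + 1) + 1)
        (Fin.cons (α := fun _ => V)
          (m (p.val + 1) fun a => x (σ ⟨a.val, by omega⟩))
          (fun b : Fin (n - (p.val + 1)) => x (σ ⟨p.val + 1 + b.val, by omega⟩)))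

/-- `(V, {lₙ}_{n ≥ 1})` is an `L∞`-algebra: `lₙ` is graded skew-symmetric of degree `2 - n` and
the higher Jacobi identities hold. -/
structure IsLInfinityAlgebra (𝒱 : ℤ → Submodule 𝕜 V) [DirectSum.Decomposition 𝒱]
    (l : MultilinearFamily 𝕜 V) : Prop where
  degree : ∀ n : ℕ, 1 ≤ n → ∀ (d : Fin n → ℤ) (x : Fin n → V), (∀ a, x a ∈ 𝒱 (d a)) →
    l n x ∈ 𝒱 ((∑ a, d a) + (2 - (n : ℤ)))
  skew_symm : ∀ n : ℕ, 1 ≤ n → ∀ (σ : Equiv.Perm (Fin n)) (d : Fin n → ℤ) (x : Fin n → V),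
    (∀ a, x a ∈ 𝒱 (d a)) → l n (fun a => x (σ a)) = skewKoszulSign σ d • l n x
  jacobi : ∀ n : ℕ, 1 ≤ n → ∀ (d : Fin n → ℤ) (x : Fin n → V), (∀ a, x a ∈ 𝒱 (d a)) →
    higherJacobiSum l l n d x = 0

/-- `(V, {lₙ}_{n ≥ 1}, {l'ₙ}_{n ≥ 1})` is a compatible `L∞`-algebra. -/
structure IsCompatibleLInfinityAlgebra (𝒱 : ℤ → Submodule 𝕜 V) [DirectSum.Decomposition 𝒱]
    (l l' : MultilinearFamily 𝕜 V) : Prop where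
  left : IsLInfinityAlgebra 𝒱 l
  right : IsLInfinityAlgebra 𝒱 l'
  compatible : ∀ n : ℕ, 1 ≤ n → ∀ (d : Fin n → ℤ) (x : Fin n → V), (∀ a, x a ∈ 𝒱 (d a)) →
    higherJacobiSum l l' n d x + higherJacobiSum l' l n d x = 0

/-- The multilinear maps `lₙ = s ∘ ρₙ ∘ (s⁻¹)^{⊗ n}` on `sV`. By the Koszul rule,
`(s⁻¹)^{⊗ n} (x₁ ⊗ ⋯ ⊗ xₙ)` is `s⁻¹ x₁ ⊗ ⋯ ⊗ s⁻¹ xₙ` with the sign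
`(-1)^{(n-1)|x₁| + (n-2)|x₂| + ⋯ + |xₙ₋₁|}`, where `|xₐ|` is the degree in `sV`. -/
noncomputable def suspendFamily (𝒱 : ℤ → Submodule 𝕜 V) [DirectSum.Decomposition 𝒱]
    (ρ : MultilinearFamily 𝕜 V) : MultilinearFamily 𝕜 V := fun n =>
  (ρ n).compLinearMap fun a => degreeInvolution (suspension 𝒱) ^ (n - 1 - a.val)

/-- The maps of `suspendFamily` on homogeneous elements of `sV`. -/
theorem suspendFamily_apply (𝒱 : ℤ → Submodule 𝕜 V) [DirectSum.Decomposition 𝒱]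
    (ρ : MultilinearFamily 𝕜 V) (n : ℕ) (d : Fin n → ℤ) (x : Fin n → V)
    (hx : ∀ a, x a ∈ suspension 𝒱 (d a)) :
    suspendFamily 𝒱 ρ n x
      = (∑ a : Fin n, ((n - 1 - a.val : ℕ) : ℤ) * d a).negOnePow • ρ n x := by
  have hpow : ∀ (m : ℕ) (i : ℤ) (y : V), y ∈ suspension 𝒱 i →
      (degreeInvolution (suspension 𝒱) ^ m) y = ((m : ℤ) * i).negOnePow • y := by
    intro m i y hy
    induction m with
    | zero => simp
    | succ m ih =>
      rw [pow_succ', Module.End.mul_apply, ih, Units.smul_def, map_zsmul,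
        degreeInvolution_of_mem _ hy, ← Units.smul_def, smul_smul, ← Int.negOnePow_add]
      congr 2
      push_cast
      ring
  have hsum : ∀ (s : Finset (Fin n)) (f : Fin n → ℤ),
      (∑ a ∈ s, f a).negOnePow = ∏ a ∈ s, (f a).negOnePow := by
    intro s f
    induction s using Finset.induction_on with
    | empty => simp
    | insert a s ha ih => rw [Finset.sum_insert ha, Finset.prod_insert ha, Int.negOnePow_add, ih]
  have hcast : ∀ (u : ℤˣ) (y : V), u • y = ((u : ℤ) : 𝕜) • y := by
    intro u y
    rw [Units.smul_def, Int.cast_smul_eq_zsmul]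
  rw [suspendFamily, MultilinearMap.compLinearMap_apply]
  simp only [fun a => hpow (n - 1 - a.val) (d a) (x a) (hx a)]
  rw [hsum]
  simp only [hcast]
  rw [MultilinearMap.map_smul_univ]
  congr 1
  push_cast
  rfl

end GradedSpaces

section VData

variable {𝕜 L : Type*} [Field 𝕜] [AddCommGroup L] [Module 𝕜 L]

/-- A graded Lie algebra structure on the graded vector space `L = ⨁ i, ℒ i`. -/
structure GradedLieStructure (ℒ : ℤ → Submodule 𝕜 L) [DirectSum.Decomposition ℒ] where
  bracket : L →ₗ[𝕜] L →ₗ[𝕜] L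
  degree : ∀ (i j : ℤ) (x y : L), x ∈ ℒ i → y ∈ ℒ j → bracket x y ∈ ℒ (i + j)
  skew_symm : ∀ (i j : ℤ) (x y : L), x ∈ ℒ i → y ∈ ℒ j →
    bracket x y = -((i * j).negOnePow • bracket y x)
  jacobi : ∀ (i j : ℤ) (x y z : L), x ∈ ℒ i → y ∈ ℒ j →
    bracket x (bracket y z)
      = bracket (bracket x y) z + (i * j).negOnePow • bracket y (bracket x z)

variable {ℒ : ℤ → Submodule 𝕜 L} [DirectSum.Decomposition ℒ]

/-- The part `(L, 𝔞, P)` of a `V`-data: an abelian graded Lie subalgebra `𝔞` of `L` and a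
(degree-preserving) projection `P` of `L` with image `𝔞` whose kernel is a Lie subalgebra.
That `𝔞` is a graded subspace follows from the fact that `P` preserves degrees. -/
structure VFrame (G : GradedLieStructure ℒ) where
  𝔞 : Submodule 𝕜 L
  P : L →ₗ[𝕜] L
  abelian : ∀ x ∈ 𝔞, ∀ y ∈ 𝔞, G.bracket x y = 0
  range_P : LinearMap.range P = 𝔞
  P_idem : ∀ x, P (P x) = P x
  P_degree : ∀ (i : ℤ), ∀ x ∈ ℒ i, P x ∈ ℒ i
  ker_subalgebra : ∀ x ∈ LinearMap.ker P, ∀ y ∈ LinearMap.ker P,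
    G.bracket x y ∈ LinearMap.ker P

/-- A `V`-data `(L, 𝔞, P, Δ)` with given `(L, 𝔞, P)`: a square-zero element `Δ ∈ ker(P)₁`. -/
structure VData {G : GradedLieStructure ℒ} (F : VFrame G) where
  Δ : L
  Δ_mem_ker : Δ ∈ LinearMap.ker F.P
  Δ_degree : Δ ∈ ℒ 1
  Δ_square_zero : G.bracket Δ Δ = 0

namespace VFrame

variable {G : GradedLieStructure ℒ} (F : VFrame G)

theorem P_mem (x : L) : F.P x ∈ F.𝔞 := F.range_P ▸ LinearMap.mem_range_self F.P x

theorem P_of_mem {x : L} (hx : x ∈ F.𝔞) : F.P x = x := by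
  rw [← F.range_P] at hx
  obtain ⟨y, rfl⟩ := hx
  exact F.P_idem y

/-- The grading `𝔞ᵢ = 𝔞 ∩ Lᵢ`. -/
def grading : ℤ → Submodule 𝕜 F.𝔞 := fun i => (ℒ i).comap F.𝔞.subtype

noncomputable instance grading.decomposition : DirectSum.Decomposition F.grading :=
  DirectSum.Decomposition.ofLinearMap F.grading
    ((DirectSum.toModule 𝕜 ℤ (⨁ i, F.grading i) fun i =>
        (DirectSum.lof 𝕜 ℤ (fun i => F.grading i) i).comp
          (LinearMap.codRestrict (F.grading i)
            (LinearMap.codRestrict F.𝔞 (F.P.comp (ℒ i).subtype) fun x => F.P_mem x)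
            fun x => F.P_degree i x x.2)).comp
      ((DirectSum.decomposeLinearEquiv ℒ).toLinearMap.comp F.𝔞.subtype))
    (by
      have key : ∀ x : L, ((DirectSum.coeLinearMap F.grading
          ((DirectSum.toModule 𝕜 ℤ (⨁ i, F.grading i) fun i =>
            (DirectSum.lof 𝕜 ℤ (fun i => F.grading i) i).comp
              (LinearMap.codRestrict (F.grading i)
                (LinearMap.codRestrict F.𝔞 (F.P.comp (ℒ i).subtype) fun x => F.P_mem x)
                fun x => F.P_degree i x x.2)) (DirectSum.decompose ℒ x)) : F.𝔞) : L)
          = F.P x := by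
        intro x
        induction x using DirectSum.Decomposition.inductionOn ℒ with
        | zero => simp
        | homogeneous m =>
          rw [DirectSum.decompose_coe, ← DirectSum.lof_eq_of 𝕜, DirectSum.toModule_lof,
            LinearMap.comp_apply, DirectSum.coeLinearMap_lof]
          rfl
        | add a b ha hb =>
          simp only [DirectSum.decompose_add, map_add, Submodule.coe_add, ha, hb]
      ext x
      exact (key x).trans (F.P_of_mem x.2))
    (by
      ext i x : 2
      obtain ⟨⟨x, hxa⟩, hx⟩ := x
      have hx' : x ∈ ℒ i := hx
      simp only [LinearMap.comp_apply, DirectSum.coeLinearMap_lof, LinearMap.id_apply,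
        LinearEquiv.coe_coe, DirectSum.decomposeLinearEquiv_apply, Submodule.subtype_apply,
        DirectSum.decompose_of_mem ℒ hx', ← DirectSum.lof_eq_of 𝕜, DirectSum.toModule_lof]
      congr 1
      exact Subtype.ext (Subtype.ext (F.P_of_mem hxa)))

end VFrame

namespace VData

variable {G : GradedLieStructure ℒ} {F : VFrame G}

/-- The iterated bracket `[⋯[[Δ, a₁], a₂], …, aₙ]`. -/
noncomputable def iteratedBracket (D : VData F) : MultilinearFamily 𝕜 L
  | 0 => MultilinearMap.constOfIsEmpty 𝕜 (fun _ : Fin 0 => L) D.Δ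
  | n + 1 => (G.bracket.compMultilinearMap (iteratedBracket D n)).uncurryRight

theorem iteratedBracket_zero (D : VData F) (a : Fin 0 → L) : D.iteratedBracket 0 a = D.Δ := rfl

theorem iteratedBracket_succ (D : VData F) (n : ℕ) (a : Fin (n + 1) → L) :
    D.iteratedBracket (n + 1) a
      = G.bracket (D.iteratedBracket n fun i => a i.castSucc) (a (Fin.last n)) := rfl

/-- The higher derived brackets `ρₙ(a₁, …, aₙ) = P [⋯[[Δ, a₁], a₂], …, aₙ]` on `𝔞`. -/
noncomputable def derivedBracket (D : VData F) : MultilinearFamily 𝕜 F.𝔞 := fun n =>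
  (LinearMap.codRestrict F.𝔞 F.P F.P_mem).compMultilinearMap
    ((D.iteratedBracket n).compLinearMap fun _ => F.𝔞.subtype)

theorem derivedBracket_coe (D : VData F) (n : ℕ) (a : Fin n → F.𝔞) :
    (D.derivedBracket n a : L) = F.P (D.iteratedBracket n fun i => (a i : L)) := rfl

/-- The maps `lₙ = s ∘ ρₙ ∘ (s⁻¹)^{⊗ n}` on `s𝔞`. -/
noncomputable def lInfinityBracket (D : VData F) : MultilinearFamily 𝕜 F.𝔞 :=
  suspendFamily F.grading D.derivedBracket

/-- Two `V`-datas `(L, 𝔞, P, Δ)` and `(L, 𝔞, P, Δ')` are compatible if `[Δ, Δ'] = 0`. -/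
def Compatible (D D' : VData F) : Prop := G.bracket D.Δ D'.Δ = 0

end VData

end VData

/-! The higher derived brackets `ρₙ` come from Leibniz expansion of an iterated bracket.
Desuspended, with degrees `e = d - 1`, the `ρₙ` have degree `1`, and they are graded symmetric
because `𝔞` is abelian. The suspension signs turn `χ(σ)(-1)^{i(j-1)}` into the plain Koszul sign for
`e`, up to one global sign (`skewKoszulSign_mul_suspensionSign_cons`). A shuffle is the same as the
subset `S` formed by its first block, so a higher Jacobi sum becomes a signed sum over subsets of
terms `P[[Δ, P[Δ', y_S]], y_T]`, where `T` is the complement of `S` and a bracket with `y_S` means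
brackets with all its members in increasing order.

That sum is controlled by `[Δ, Δ'] = 0`. Bracketing this with all `yₐ` and using the Leibniz rule
(`finsetBracket_bracket`) gives `0 = ∑ ± [Δ_S, Δ'_T]`, with `Δ_S = [Δ, y_S]`. Applying `P` and `P[u,
v] = P[Pu, v] + P[u, Pv]` (`VFrame.P_bracket`) splits each term in two. In each half the factor in
the image of `P` commutes with every `yₐ`, so it moves to the front (`bracket_finsetBracket`), and
the halves become the terms of the two mixed Jacobi sums (`sum_powerset_derived`).

This is compatibility. Taking `Δ' = Δ` gives twice the Jacobi sum of one structure, and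
characteristic `0` removes the factor `2`. -/

/-! ### Koszul signs, suspension signs and how they combine under permutations. -/

section Signs

theorem map_intUnits_smul {M N : Type*} [AddCommGroup M] [AddCommGroup N] {H : Type*}
    [FunLike H M N] [AddMonoidHomClass H M N] (f : H) (u : ℤˣ) (x : M) : f (u • x) = u • f x := by
  rw [Units.smul_def, map_zsmul, Units.smul_def]

theorem Int.negOnePow_eq_of_even_sub {a b : ℤ} (h : Even (a - b)) :
    a.negOnePow = b.negOnePow := by
  rw [← sub_add_cancel a b, Int.negOnePow_add, Int.negOnePow_even _ h, one_mul]

/-- A product over ordered pairs of a symmetric function does not change under a permutation. -/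
theorem prod_lt_comp_perm {ι M : Type*} [LinearOrder ι] [Fintype ι] [CommMonoid M]
    (τ : Equiv.Perm ι) (g : ι → ι → M) (hg : ∀ a b, g a b = g b a) :
    ∏ p ∈ (Finset.univ : Finset (ι × ι)).filter (fun p => p.1 < p.2), g (τ p.1) (τ p.2)
      = ∏ p ∈ (Finset.univ : Finset (ι × ι)).filter (fun p => p.1 < p.2), g p.1 p.2 := by
  have key : ∀ (τ : Equiv.Perm ι) (p : ι × ι), p.1 < p.2 →
      ¬ τ p.1 < τ p.2 → τ p.2 < τ p.1 := fun τ p hp h =>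
    lt_of_le_of_ne (not_lt.1 h) fun h' => hp.ne' (τ.injective h')
  refine Finset.prod_nbij'
    (fun p => if τ p.1 < τ p.2 then (τ p.1, τ p.2) else (τ p.2, τ p.1))
    (fun p => if τ⁻¹ p.1 < τ⁻¹ p.2 then (τ⁻¹ p.1, τ⁻¹ p.2) else (τ⁻¹ p.2, τ⁻¹ p.1)) ?_ ?_ ?_ ?_ ?_
  · intro p hp
    simp only [Finset.mem_filter, Finset.mem_univ, true_and] at hp ⊢
    split_ifs with h
    · exact h
    · exact key τ p hp h
  · intro p hp
    simp only [Finset.mem_filter, Finset.mem_univ, true_and] at hp ⊢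
    split_ifs with h
    · exact h
    · exact key τ⁻¹ p hp h
  · rintro ⟨a, b⟩ hp
    simp only [Finset.mem_filter, Finset.mem_univ, true_and] at hp
    by_cases h : τ a < τ b <;> simp [h, hp, hp.not_gt]
  · rintro ⟨a, b⟩ hp
    simp only [Finset.mem_filter, Finset.mem_univ, true_and] at hp
    by_cases h : τ⁻¹ a < τ⁻¹ b
    · simp only [h, if_true]
      simp [hp]
    · simp only [h, if_false]
      simp [hp.not_gt]
  · rintro ⟨a, b⟩ _
    by_cases h : τ a < τ b
    · simp [h]
    · simp [h, hg (τ a)]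

theorem koszulSign_eq_prod_ite {n : ℕ} (σ : Equiv.Perm (Fin n)) (d : Fin n → ℤ) :
    koszulSign σ d
      = ∏ p ∈ (Finset.univ : Finset (Fin n × Fin n)).filter (fun p => p.1 < p.2),
          if σ p.2 < σ p.1 then (d (σ p.1) * d (σ p.2)).negOnePow else 1 := by
  rw [koszulSign, ← Finset.filter_filter]
  exact Finset.prod_filter _ _

/-- `σ * τ` inverts a pair exactly when one, but not both, of these holds: `τ` inverts the pair, or
`σ` inverts its image under `τ`. If both hold, the pair's weight appears twice and squares to `1`.
The auxiliary `g` is symmetric so that the factor for `σ` can be reindexed along `τ`. -/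
theorem koszulSign_mul {n : ℕ} (σ τ : Equiv.Perm (Fin n)) (d : Fin n → ℤ) :
    koszulSign (σ * τ) d = koszulSign τ (fun a => d (σ a)) * koszulSign σ d := by
  set w : Fin n → Fin n → ℤˣ := fun a b => (d (σ a) * d (σ b)).negOnePow with hw
  have hws : ∀ a b, w a b = w b a := fun a b => by simp only [hw, mul_comm]
  set g : Fin n → Fin n → ℤˣ := fun a b =>
    if (a < b ∧ σ b < σ a) ∨ (b < a ∧ σ a < σ b) then w a b else 1 with hg
  have hgs : ∀ a b, g a b = g b a := fun a b => by
    simp only [hg, hws a b, or_comm]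
  have h2 : koszulSign σ d
      = ∏ p ∈ (Finset.univ : Finset (Fin n × Fin n)).filter (fun p => p.1 < p.2),
          g p.1 p.2 := by
    rw [koszulSign_eq_prod_ite]
    refine Finset.prod_congr rfl fun p hp => ?_
    have hp' : p.1 < p.2 := (Finset.mem_filter.1 hp).2
    simp [hg, hw, hp', hp'.not_gt]
  rw [h2, ← prod_lt_comp_perm τ g hgs, koszulSign_eq_prod_ite, koszulSign_eq_prod_ite,
    ← Finset.prod_mul_distrib]
  refine Finset.prod_congr rfl fun p hp => ?_
  have hp' : p.1 < p.2 := (Finset.mem_filter.1 hp).2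
  have hne : τ p.1 ≠ τ p.2 := fun h => hp'.ne (τ.injective h)
  have hne' : σ (τ p.1) ≠ σ (τ p.2) := fun h => hne (σ.injective h)
  simp only [Equiv.Perm.mul_apply, hg]
  rcases lt_or_gt_of_ne hne with h | h <;> rcases lt_or_gt_of_ne hne' with h' | h' <;>
    simp [h, h', h.not_gt, h'.not_gt, hw, Int.units_mul_self]

theorem koszulSign_one {n : ℕ} (d : Fin n → ℤ) : koszulSign 1 d = 1 := by
  refine Finset.prod_eq_one fun p hp => ?_
  have := (Finset.mem_filter.1 hp).2
  exact absurd this.1 this.2.not_gt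

theorem koszulSign_swap {n : ℕ} (i : Fin n) (d : Fin (n + 1) → ℤ) :
    koszulSign (Equiv.swap i.castSucc i.succ) d = (d i.castSucc * d i.succ).negOnePow := by
  rw [koszulSign, Finset.prod_eq_single (i.castSucc, i.succ)]
  · simp [mul_comm]
  · rintro ⟨a, b⟩ hp hne
    exfalso
    apply hne
    obtain ⟨h1, h2⟩ := (Finset.mem_filter.1 hp).2
    simp only [Equiv.swap_apply_def] at h2
    simp only [Fin.ext_iff, Fin.lt_def, Prod.ext_iff, Fin.val_castSucc, Fin.val_succ] at *
    split_ifs at h2 <;> (try simp only [Fin.val_castSucc, Fin.val_succ] at h2) <;> omega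
  · intro h
    exfalso
    apply h
    simp

theorem skewKoszulSign_mul {n : ℕ} (σ τ : Equiv.Perm (Fin n)) (d : Fin n → ℤ) :
    skewKoszulSign (σ * τ) d = skewKoszulSign τ (fun a => d (σ a)) * skewKoszulSign σ d := by
  simp only [skewKoszulSign, koszulSign_mul, Equiv.Perm.sign_mul]
  ac_rfl

theorem skewKoszulSign_one {n : ℕ} (d : Fin n → ℤ) : skewKoszulSign 1 d = 1 := by
  simp [skewKoszulSign, koszulSign_one]

theorem skewKoszulSign_swap {n : ℕ} (i : Fin n) (d : Fin (n + 1) → ℤ) :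
    skewKoszulSign (Equiv.swap i.castSucc i.succ) d
      = (d i.castSucc * d i.succ + 1).negOnePow := by
  rw [skewKoszulSign, koszulSign_swap, Equiv.Perm.sign_swap i.castSucc_lt_succ.ne,
    Int.negOnePow_succ, neg_one_mul]

/-- Induction over permutations of `Fin n` through adjacent transpositions. -/
theorem perm_fin_induction {motive : ∀ {n : ℕ}, Equiv.Perm (Fin n) → Prop}
    (one : ∀ n, motive (1 : Equiv.Perm (Fin n)))
    (mul : ∀ {n} (σ τ : Equiv.Perm (Fin n)), motive σ → motive τ → motive (σ * τ))
    (swap : ∀ {n} (i : Fin n), motive (Equiv.swap i.castSucc i.succ))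
    {n : ℕ} (σ : Equiv.Perm (Fin n)) : motive σ := by
  cases n with
  | zero => rw [Subsingleton.elim σ 1]; exact one 0
  | succ n =>
    have h : σ ∈ Submonoid.closure (Set.range fun i : Fin n => Equiv.swap i.castSucc i.succ) := by
      rw [Equiv.Perm.mclosure_swap_castSucc_succ]; trivial
    induction h using Submonoid.closure_induction with
    | mem x hx => obtain ⟨i, rfl⟩ := hx; exact swap i
    | one => exact one _
    | mul x y _ _ hx hy => exact mul x y hx hy

/-- The sign of `(s⁻¹)^{⊗ n}` on elements of degrees `d₁, …, dₙ`. -/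
def suspensionSign {n : ℕ} (d : Fin n → ℤ) : ℤˣ :=
  (∑ a : Fin n, ((n - 1 - a.val : ℕ) : ℤ) * d a).negOnePow

theorem suspensionSign_swap {n : ℕ} (i : Fin n) (d : Fin (n + 1) → ℤ) :
    suspensionSign (fun a => d (Equiv.swap i.castSucc i.succ a))
      = (d i.castSucc + d i.succ).negOnePow * suspensionSign d := by
  have hne : i.castSucc ≠ i.succ := i.castSucc_lt_succ.ne
  rw [suspensionSign, suspensionSign, ← Int.negOnePow_add]
  apply Int.negOnePow_eq_of_even_sub
  rw [← sub_sub, sub_right_comm, ← Finset.sum_sub_distrib,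
    ← Finset.sum_subset (Finset.subset_univ {i.castSucc, i.succ}), Finset.sum_pair hne]
  · simp only [Equiv.swap_apply_left, Equiv.swap_apply_right, Fin.val_castSucc, Fin.val_succ,
      Nat.add_sub_cancel]
    have h1 : ((n - i.val : ℕ) : ℤ) = ((n - (i.val + 1) : ℕ) : ℤ) + 1 := by
      have := i.isLt; omega
    rw [h1]
    -- The two weights differ by one, so the exponents differ by `d i.succ - d i.castSucc`, which
    -- has the parity of the sum.
    exact ⟨-d i.castSucc, by ring⟩
  · intro a _ ha
    simp only [Finset.mem_insert, Finset.mem_singleton, not_or] at ha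
    rw [Equiv.swap_apply_of_ne_of_ne ha.1 ha.2, sub_self]

/-- The suspension turns skew Koszul signs into Koszul signs for degrees lowered by one. -/
theorem skewKoszulSign_mul_suspensionSign {n : ℕ} (σ : Equiv.Perm (Fin n)) (d : Fin n → ℤ) :
    skewKoszulSign σ d * suspensionSign d
      = koszulSign σ (fun a => d a - 1) * suspensionSign fun a => d (σ a) := by
  induction σ using perm_fin_induction with
  | one n => simp [skewKoszulSign_one, koszulSign_one]
  | mul σ τ hσ hτ =>
    rw [skewKoszulSign_mul, koszulSign_mul, mul_assoc, hσ, mul_left_comm, hτ]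
    simp only [Equiv.Perm.mul_apply]
    ac_rfl
  | swap i =>
    rw [suspensionSign_swap, skewKoszulSign_swap, koszulSign_swap, ← mul_assoc,
      ← Int.negOnePow_add]
    congr 1
    apply Int.negOnePow_eq_of_even_sub
    -- For adjacent degrees `p`, `q` this is `p q + 1 = (p - 1)(q - 1) + (p + q)`.
    exact ⟨0, by ring⟩

end Signs

/-! ### Iterated brackets along a list and the derivation property. -/

section NestedBrackets

variable {𝕜 L : Type*} [Field 𝕜] [AddCommGroup L] [Module 𝕜 L]
  {ℒ : ℤ → Submodule 𝕜 L} [DirectSum.Decomposition ℒ]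

namespace GradedLieStructure

variable (G : GradedLieStructure ℒ)

/-- The iterated bracket `[⋯[[w, a₁], a₂], …, aₙ]` for a list `a₁, …, aₙ`. -/
def nestedBracket (w : L) (l : List L) : L := l.foldl (fun u v => G.bracket u v) w

theorem nestedBracket_cons (w a : L) (l : List L) :
    G.nestedBracket w (a :: l) = G.nestedBracket (G.bracket w a) l := rfl

theorem nestedBracket_append_singleton (w a : L) (l : List L) :
    G.nestedBracket w (l ++ [a]) = G.bracket (G.nestedBracket w l) a := by
  simp [nestedBracket]

theorem nestedBracket_zero (l : List L) : G.nestedBracket 0 l = 0 := by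
  induction l with
  | nil => rfl
  | cons a l ih => rw [nestedBracket_cons, map_zero, LinearMap.zero_apply, ih]

theorem bracket_units_smul_left (u : ℤˣ) (v w : L) :
    G.bracket (u • v) w = u • G.bracket v w := by
  rw [map_intUnits_smul]; rfl

/-- The bracket with `a` from the right is a graded derivation. -/
theorem bracket_bracket_right {i j k : ℤ} {u v a : L} (hu : u ∈ ℒ i) (hv : v ∈ ℒ j)
    (ha : a ∈ ℒ k) :
    G.bracket (G.bracket u v) a
      = G.bracket u (G.bracket v a) + (j * k).negOnePow • G.bracket (G.bracket u a) v := by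
  rw [G.jacobi i j u v a hu hv,
    G.skew_symm j (i + k) v (G.bracket u a) hv (G.degree i k u a hu ha), smul_neg, smul_smul,
    ← Int.negOnePow_add, Int.negOnePow_eq_of_even_sub (b := j * k) ⟨i * j, by ring⟩]
  abel

/-- Brackets with commuting elements commute up to the Koszul sign. -/
theorem bracket_right_comm {i j k : ℤ} {u v a : L} (hu : u ∈ ℒ i) (hv : v ∈ ℒ j)
    (ha : a ∈ ℒ k) (h : G.bracket v a = 0) :
    G.bracket (G.bracket u v) a = (j * k).negOnePow • G.bracket (G.bracket u a) v := by
  rw [G.bracket_bracket_right hu hv ha, h, map_zero, zero_add]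

end GradedLieStructure

end NestedBrackets

/-! ### Iterated brackets along finite index sets, and the Jacobi identity as a sum over subsets. -/

section FinsetBrackets

variable {𝕜 L ι : Type*} [Field 𝕜] [AddCommGroup L] [Module 𝕜 L]
  {ℒ : ℤ → Submodule 𝕜 L} [DirectSum.Decomposition ℒ] [LinearOrder ι]

theorem Finset.sort_insert_of_forall_lt {S : Finset ι} {a : ι} (h : ∀ b ∈ S, b < a) :
    (insert a S).sort (· ≤ ·) = S.sort (· ≤ ·) ++ [a] := by
  have hnd : (S.sort (· ≤ ·) ++ [a]).Nodup := by
    rw [List.nodup_append]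
    refine ⟨S.sort_nodup _, List.nodup_singleton a, ?_⟩
    intro b hb c hc hbc
    rw [List.mem_singleton] at hc
    subst hc hbc
    exact lt_irrefl _ (h b ((Finset.mem_sort _).1 hb))
  have hS : (S.sort (· ≤ ·) ++ [a]).toFinset = insert a S := by
    ext b; simp
  rw [← hS, List.toFinset_sort _ hnd, List.pairwise_append]
  refine ⟨S.pairwise_sort _, List.pairwise_singleton _ a, ?_⟩
  intro b hb c hc
  rw [List.mem_singleton] at hc
  subst hc
  exact (h b ((Finset.mem_sort _).1 hb)).le

/-- The Koszul sign of the unshuffle that moves the indices in `S` before those in `T`, for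
elements of degrees `e`. -/
def unshuffleSign (e : ι → ℤ) (S T : Finset ι) : ℤˣ :=
  ∏ q ∈ S, ∏ p ∈ T.filter (· < q), (e q * e p).negOnePow

/-- A new largest index in the second block is never passed by an element of the first. -/
theorem unshuffleSign_insert_right (e : ι → ℤ) {S T : Finset ι} {a : ι}
    (hS : ∀ b ∈ S, b < a) : unshuffleSign e S (insert a T) = unshuffleSign e S T := by
  refine Finset.prod_congr rfl fun q hq => ?_
  rw [Finset.filter_insert, if_neg (hS q hq).not_gt]

theorem Int.negOnePow_sum (s : Finset ι) (f : ι → ℤ) :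
    (∑ a ∈ s, f a).negOnePow = ∏ a ∈ s, (f a).negOnePow := by
  induction s using Finset.induction_on with
  | empty => simp
  | insert a s ha ih => rw [Finset.sum_insert ha, Finset.prod_insert ha, Int.negOnePow_add, ih]

theorem unshuffleSign_insert_left (e : ι → ℤ) {S T : Finset ι} {a : ι}
    (hS : ∀ b ∈ S, b < a) (hT : ∀ b ∈ T, b < a) :
    unshuffleSign e (insert a S) T = (e a * ∑ b ∈ T, e b).negOnePow * unshuffleSign e S T := by
  rw [unshuffleSign, Finset.prod_insert fun h => lt_irrefl _ (hS a h),
    Finset.filter_true_of_mem hT, Finset.mul_sum, Int.negOnePow_sum]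
  rfl

/-- By disjointness, each pair in `S × T` is counted in exactly one of the two signs, according to
which index is larger. -/
theorem unshuffleSign_symm (e : ι → ℤ) {S T : Finset ι} (h : Disjoint S T) :
    unshuffleSign e S T * unshuffleSign e T S
      = ((∑ a ∈ S, e a) * ∑ b ∈ T, e b).negOnePow := by
  have h1 : unshuffleSign e T S
      = ∏ q ∈ S, ∏ p ∈ T.filter (¬ · < q), (e q * e p).negOnePow := by
    simp only [unshuffleSign, Finset.prod_filter]
    rw [Finset.prod_comm]
    refine Finset.prod_congr rfl fun q hq => Finset.prod_congr rfl fun p hp => ?_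
    have hne : q ≠ p := fun h' => Finset.disjoint_left.1 h hq (h' ▸ hp)
    rw [mul_comm (e p)]
    congr 1
    simp only [not_lt, eq_iff_iff]
    exact ⟨le_of_lt, fun h => lt_of_le_of_ne h hne⟩
  rw [h1, unshuffleSign, ← Finset.prod_mul_distrib, Finset.sum_mul, Int.negOnePow_sum]
  refine Finset.prod_congr rfl fun q _ => ?_
  rw [Finset.prod_filter_mul_prod_filter_not, Finset.mul_sum, Int.negOnePow_sum]

namespace GradedLieStructure

variable (G : GradedLieStructure ℒ) (y : ι → L) (e : ι → ℤ)

/-- The iterated bracket of `w` with the `yₐ`, `a ∈ S`, in increasing order of the indices. -/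
def finsetBracket (w : L) (S : Finset ι) : L := G.nestedBracket w ((S.sort (· ≤ ·)).map y)

theorem finsetBracket_empty (w : L) : G.finsetBracket y w ∅ = w := by
  simp [finsetBracket, nestedBracket]

theorem finsetBracket_insert (w : L) {S : Finset ι} {a : ι} (h : ∀ b ∈ S, b < a) :
    G.finsetBracket y w (insert a S) = G.bracket (G.finsetBracket y w S) (y a) := by
  rw [finsetBracket, Finset.sort_insert_of_forall_lt h, List.map_append, List.map_singleton,
    nestedBracket_append_singleton]
  rfl

theorem finsetBracket_zero (S : Finset ι) : G.finsetBracket y 0 S = 0 := G.nestedBracket_zero _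

variable {y e}

theorem finsetBracket_mem (hy : ∀ a, y a ∈ ℒ (e a)) {i : ℤ} {w : L} (hw : w ∈ ℒ i)
    (S : Finset ι) : G.finsetBracket y w S ∈ ℒ (i + ∑ a ∈ S, e a) := by
  induction S using Finset.induction_on_max with
  | empty => simpa [finsetBracket_empty] using hw
  | insert a S h ih =>
    rw [finsetBracket_insert G y w h, Finset.sum_insert fun h' => lt_irrefl _ (h a h'),
      add_comm (e a), ← add_assoc]
    exact G.degree _ _ _ _ ih (hy a)

/-- The bracket with an element `u` that commutes with all `yₐ` may be moved to the front. -/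
theorem bracket_finsetBracket (hy : ∀ a, y a ∈ ℒ (e a)) {i j : ℤ} {w u : L} (hw : w ∈ ℒ i)
    (hu : u ∈ ℒ j) (h0 : ∀ a, G.bracket (y a) u = 0) (S : Finset ι) :
    G.bracket (G.finsetBracket y w S) u
      = (j * ∑ a ∈ S, e a).negOnePow • G.finsetBracket y (G.bracket w u) S := by
  induction S using Finset.induction_on_max with
  | empty => simp [finsetBracket_empty]
  | insert a S h ih =>
    rw [finsetBracket_insert G y _ h, finsetBracket_insert G y _ h,
      G.bracket_right_comm (G.finsetBracket_mem hy hw S) (hy a) hu (h0 a), ih,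
      bracket_units_smul_left, smul_smul, ← Int.negOnePow_add,
      Finset.sum_insert fun h' => lt_irrefl _ (h a h')]
    congr 2
    ring

/-- The Leibniz rule for the iterated bracket of `[u, v]`. -/
theorem finsetBracket_bracket (hy : ∀ a, y a ∈ ℒ (e a)) {u v : L} (hu : u ∈ ℒ 1)
    (hv : v ∈ ℒ 1) (U : Finset ι) :
    G.finsetBracket y (G.bracket u v) U
      = ∑ S ∈ U.powerset, ((∑ a ∈ S, e a).negOnePow * unshuffleSign e S (U \ S)) •
          G.bracket (G.finsetBracket y u S) (G.finsetBracket y v (U \ S)) := by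
  induction U using Finset.induction_on_max with
  | empty => simp [finsetBracket_empty, unshuffleSign]
  | insert a U h ih =>
    have haU : a ∉ U := fun h' => lt_irrefl _ (h a h')
    -- The largest index is bracketed last, and the derivation rule sends it to one of the two
    -- factors. These cases match the subsets of `insert a U` without `a` and with `a`.
    rw [finsetBracket_insert G y _ h, ih, Finset.sum_powerset_insert haU,
      ← Finset.sum_add_distrib, map_sum, LinearMap.sum_apply]
    refine Finset.sum_congr rfl fun S hS => ?_
    have hSU := Finset.mem_powerset.1 hS
    have hS' : ∀ b ∈ S, b < a := fun b hb => h b (hSU hb)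
    have hT' : ∀ b ∈ U \ S, b < a := fun b hb => h b (Finset.mem_sdiff.1 hb).1
    have haS : a ∉ S := fun h' => haU (hSU h')
    rw [bracket_units_smul_left, G.bracket_bracket_right (G.finsetBracket_mem hy hu S)
      (G.finsetBracket_mem hy hv (U \ S)) (hy a), Finset.insert_sdiff_of_notMem _ haS,
      Finset.insert_sdiff_insert, Finset.sdiff_insert_of_notMem haU,
      finsetBracket_insert G y v hT', finsetBracket_insert G y u hS',
      unshuffleSign_insert_right e hS', unshuffleSign_insert_left e hS' hT',
      Finset.sum_insert haS, smul_add, smul_smul]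
    congr 2
    -- Passing `y a` across the `v` factor, of degree `1 + ∑ e` over `U \ S`, costs `e a` for `v`,
    -- which extends the sum over `S`, and the product with the remaining degrees, which extends the
    -- unshuffle sign.
    rw [add_mul, one_mul, Int.negOnePow_add, Int.negOnePow_add, mul_comm (e a) (∑ b ∈ _, _)]
    ac_rfl

end GradedLieStructure

namespace VFrame

variable {G : GradedLieStructure ℒ} (F : VFrame G)

/-- `u - P u` and `v - P v` lie in the kernel, hence so does their bracket. Expand it and drop `[P
u, P v]`, which vanishes since `𝔞` is abelian. -/
theorem P_bracket (u v : L) :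
    F.P (G.bracket u v) = F.P (G.bracket (F.P u) v) + F.P (G.bracket u (F.P v)) := by
  have hk : ∀ u, u - F.P u ∈ LinearMap.ker F.P := fun u => by
    rw [LinearMap.mem_ker, map_sub, F.P_idem, sub_self]
  have h := F.ker_subalgebra _ (hk u) _ (hk v)
  simp only [LinearMap.mem_ker, map_sub, LinearMap.sub_apply,
    F.abelian _ (F.P_mem u) _ (F.P_mem v), sub_zero] at h
  rw [← sub_eq_zero, ← h]
  abel

variable {y : ι → L} {e : ι → ℤ}

/-- The higher Jacobi identity for two higher derived brackets, as a sum over subsets. -/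
theorem sum_powerset_derived (hy : ∀ a, y a ∈ ℒ (e a)) (hya : ∀ a, y a ∈ F.𝔞) {u v : L}
    (hu : u ∈ ℒ 1) (hv : v ∈ ℒ 1) (huv : G.bracket u v = 0) (U : Finset ι) :
    ∑ S ∈ U.powerset, unshuffleSign e S (U \ S) •
        F.P (G.finsetBracket y (G.bracket u (F.P (G.finsetBracket y v S))) (U \ S))
      + ∑ S ∈ U.powerset, unshuffleSign e S (U \ S) •
        F.P (G.finsetBracket y (G.bracket v (F.P (G.finsetBracket y u S))) (U \ S)) = 0 := by
  have hPdeg : ∀ {w : L}, w ∈ ℒ 1 → ∀ S : Finset ι,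
      F.P (G.finsetBracket y w S) ∈ ℒ (1 + ∑ a ∈ S, e a) := fun hw S =>
    F.P_degree _ _ (G.finsetBracket_mem hy hw S)
  have hmove : ∀ {w w' : L}, w ∈ ℒ 1 → w' ∈ ℒ 1 → ∀ S T : Finset ι,
      G.bracket (G.finsetBracket y w S) (F.P (G.finsetBracket y w' T))
        = ((1 + ∑ a ∈ T, e a) * ∑ a ∈ S, e a).negOnePow •
          G.finsetBracket y (G.bracket w (F.P (G.finsetBracket y w' T))) S := fun hw hw' S T =>
    G.bracket_finsetBracket hy hw (hPdeg hw' T)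
      (fun a => F.abelian _ (hya a) _ (F.P_mem _)) S
  -- Complementing `S` in the first sum makes `u` collect `S` and `v` collect `U \ S` in both sums.
  have h1 : ∑ S ∈ U.powerset, unshuffleSign e S (U \ S) •
        F.P (G.finsetBracket y (G.bracket u (F.P (G.finsetBracket y v S))) (U \ S))
      = ∑ S ∈ U.powerset, unshuffleSign e (U \ S) S •
        F.P (G.finsetBracket y (G.bracket u (F.P (G.finsetBracket y v (U \ S)))) S) := by
    refine Finset.sum_nbij' (fun S => U \ S) (fun S => U \ S) ?_ ?_ ?_ ?_ ?_
    · intro S _; exact Finset.mem_powerset.2 Finset.sdiff_subset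
    · intro S _; exact Finset.mem_powerset.2 Finset.sdiff_subset
    · intro S hS; exact Finset.sdiff_sdiff_eq_self (Finset.mem_powerset.1 hS)
    · intro S hS; exact Finset.sdiff_sdiff_eq_self (Finset.mem_powerset.1 hS)
    · intro S hS; simp only [Finset.sdiff_sdiff_eq_self (Finset.mem_powerset.1 hS)]
  have h2 := congrArg F.P (G.finsetBracket_bracket hy hu hv U)
  rw [huv, G.finsetBracket_zero, map_zero, map_sum] at h2
  -- The right-hand `0` is replaced by the projected Leibniz expansion of `[u, v]`, so the identity
  -- can be checked for each `S` separately.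
  rw [h1, ← Finset.sum_add_distrib, h2]
  refine Finset.sum_congr rfl fun S _ => ?_
  have hs : unshuffleSign e (U \ S) S = unshuffleSign e S (U \ S) *
      ((∑ a ∈ S, e a) * ∑ b ∈ U \ S, e b).negOnePow := by
    rw [← unshuffleSign_symm e Finset.disjoint_sdiff, ← mul_assoc, Int.units_mul_self, one_mul]
  rw [map_intUnits_smul, F.P_bracket, smul_add, add_comm, hmove hu hv,
    G.skew_symm _ _ _ _ (hPdeg hu S) (G.finsetBracket_mem hy hv (U \ S)), hmove hv hu, hs,
    map_neg, map_intUnits_smul, map_intUnits_smul, map_intUnits_smul, ← Units.neg_smul,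
    smul_smul, smul_smul, smul_smul]
  generalize (∑ a ∈ S, e a) = A
  generalize (∑ a ∈ U \ S, e a) = B
  generalize unshuffleSign e S (U \ S) = c
  congr 2
  · rw [mul_comm A.negOnePow c, ← Int.negOnePow_succ, mul_assoc, mul_assoc,
      ← Int.negOnePow_add, ← Int.negOnePow_add, Int.negOnePow_even _ ⟨A + 1 + B * (1 + A), by ring⟩, mul_one]
  · rw [mul_comm A.negOnePow c, mul_assoc, ← Int.negOnePow_add]
    congr 1
    exact Int.negOnePow_eq_of_even_sub ⟨-A, by ring⟩

end VFrame

end FinsetBrackets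

/-! ### Shuffles as subsets, and the total sign of a Jacobi term. -/

section Shuffles

/-- The values of a permutation of `Fin n` on the first `i` positions. -/
def firstBlock {n : ℕ} (i : ℕ) (σ : Equiv.Perm (Fin n)) : Finset (Fin n) :=
  Finset.univ.filter fun b => (σ.symm b).val < i

theorem ofFn_eq_sort {n i : ℕ} {S : Finset (Fin n)} (f : Fin i → Fin n) (hf : StrictMono f)
    (hS : ∀ b, b ∈ S ↔ ∃ a, f a = b) : List.ofFn f = S.sort (· ≤ ·) := by
  have hl : (List.ofFn f).toFinset = S := by
    ext b; simp [hS]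
  rw [← hl, eq_comm, List.toFinset_sort _ (List.nodup_ofFn.2 hf.injective), List.pairwise_ofFn]
  exact fun a b h => (hf h).le

theorem ofFn_firstBlock {n i k : ℕ} (h : i + k = n) {σ : Equiv.Perm (Fin n)}
    (hσ : σ ∈ shuffles i n) :
    List.ofFn (fun a : Fin i => σ ⟨a.val, by omega⟩) = (firstBlock i σ).sort (· ≤ ·) := by
  refine ofFn_eq_sort _ (fun a b hab => (Finset.mem_filter.1 hσ).2.1 _ _ hab b.isLt) fun b => ?_
  simp only [firstBlock, Finset.mem_filter, Finset.mem_univ, true_and]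
  constructor
  · intro hb
    exact ⟨⟨_, hb⟩, by simp⟩
  · rintro ⟨a, rfl⟩
    simp

theorem ofFn_firstBlock_compl {n i k : ℕ} (h : i + k = n) {σ : Equiv.Perm (Fin n)}
    (hσ : σ ∈ shuffles i n) :
    List.ofFn (fun b : Fin k => σ ⟨i + b.val, by omega⟩)
      = (Finset.univ \ firstBlock i σ).sort (· ≤ ·) := by
  refine ofFn_eq_sort _ (fun a b hab => (Finset.mem_filter.1 hσ).2.2 _ _
    (by simpa using hab) (by simp)) fun b => ?_
  simp only [firstBlock, Finset.mem_sdiff, Finset.mem_filter, Finset.mem_univ, true_and, not_lt]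
  constructor
  · intro hb
    refine ⟨⟨(σ.symm b).val - i, by omega⟩, ?_⟩
    simp [Nat.add_sub_cancel' hb]
  · rintro ⟨a, rfl⟩
    simp

/-- Both blocks of a shuffle are increasing enumerations, so the set of values on the first block
determines everything. -/
theorem firstBlock_injOn {n i k : ℕ} (h : i + k = n) :
    Set.InjOn (firstBlock i : Equiv.Perm (Fin n) → _) (shuffles i n) := by
  intro σ hσ τ hτ hst
  have h1 := (ofFn_firstBlock h hσ).trans ((congrArg (Finset.sort · (· ≤ ·)) hst).trans (ofFn_firstBlock h hτ).symm)
  have h2 := (ofFn_firstBlock_compl h hσ).trans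
    ((congrArg (fun S => (Finset.univ \ S).sort (· ≤ ·)) hst).trans
      (ofFn_firstBlock_compl h hτ).symm)
  have h1' := List.ofFn_injective h1
  have h2' := List.ofFn_injective h2
  ext a : 1
  by_cases ha : a.val < i
  · exact congrFun h1' ⟨a.val, ha⟩
  · have := congrFun h2' ⟨a.val - i, by omega⟩
    simpa [Nat.add_sub_cancel' (not_lt.1 ha)] using this

theorem card_firstBlock {n i k : ℕ} (h : i + k = n) {σ : Equiv.Perm (Fin n)}
    (hσ : σ ∈ shuffles i n) : (firstBlock i σ).card = i := by
  rw [← Finset.length_sort (· ≤ ·), ← ofFn_firstBlock h hσ, List.length_ofFn]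

theorem exists_firstBlock_eq {n i k : ℕ} (h : i + k = n) {S : Finset (Fin n)}
    (hS : S.card = i) : ∃ σ ∈ shuffles i n, firstBlock i σ = S := by
  subst h
  have hc : Sᶜ.card = k := by rw [Finset.card_compl, Fintype.card_fin, hS]; omega
  -- The increasing enumeration of `S` followed by that of its complement.
  set σ : Equiv.Perm (Fin (i + k)) :=
    finSumFinEquiv.symm.trans (finSumEquivOfFinset hS hc) with hσ
  have h1 : ∀ a, σ (Fin.castAdd k a) = S.orderEmbOfFin hS a := fun a => by simp [hσ]
  have h2 : ∀ b, σ (Fin.natAdd i b) = Sᶜ.orderEmbOfFin hc b := fun b => by simp [hσ]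
  refine ⟨σ, Finset.mem_filter.2 ⟨Finset.mem_univ _, ?_, ?_⟩, ?_⟩
  · intro a b hab hb
    have ha : a.val < i := lt_trans hab hb
    calc σ a = S.orderEmbOfFin hS ⟨a.val, ha⟩ := h1 ⟨a.val, ha⟩
      _ < S.orderEmbOfFin hS ⟨b.val, hb⟩ := (S.orderEmbOfFin hS).strictMono hab
      _ = σ b := (h1 ⟨b.val, hb⟩).symm
  · intro a b hab ha
    induction a using Fin.addCases with
    | left a => exact absurd ha (by simp)
    | right a =>
      induction b using Fin.addCases with
      | left b => simp [Fin.lt_def] at hab; omega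
      | right b =>
        rw [h2, h2]
        exact (Sᶜ.orderEmbOfFin hc).strictMono (by simpa using hab)
  · ext b
    obtain ⟨c, rfl⟩ := σ.surjective b
    simp only [firstBlock, Finset.mem_filter, Finset.mem_univ, true_and, Equiv.symm_apply_apply]
    induction c using Fin.addCases with
    | left a => rw [h1]; simp [Finset.orderEmbOfFin_mem]
    | right a =>
      rw [h2]
      have := Finset.mem_compl.1 (Finset.orderEmbOfFin_mem Sᶜ hc a)
      simp [this]

theorem sum_shuffles {M : Type*} [AddCommMonoid M] {n i k : ℕ} (h : i + k = n)
    (g : Finset (Fin n) → M) :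
    ∑ σ ∈ shuffles i n, g (firstBlock i σ) = ∑ S ∈ Finset.powersetCard i Finset.univ, g S := by
  refine Finset.sum_nbij (firstBlock i) ?_ (firstBlock_injOn h) ?_ fun _ _ => rfl
  · intro σ hσ
    exact Finset.mem_powersetCard.2 ⟨Finset.subset_univ _, card_firstBlock h hσ⟩
  · intro S hS
    obtain ⟨σ, hσ, h'⟩ := exists_firstBlock_eq h (Finset.mem_powersetCard.1 hS).2
    exact ⟨σ, hσ, h'⟩

/-- Subsets are grouped by cardinality. The blocks here have size `p + 1 ≥ 1`, so the empty set is
never reached and its term has to vanish. -/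
theorem sum_sum_shuffles {M : Type*} [AddCommMonoid M] {n : ℕ} (g : Finset (Fin n) → M)
    (g0 : g ∅ = 0) :
    ∑ p : Fin n, ∑ σ ∈ shuffles (p.val + 1) n, g (firstBlock (p.val + 1) σ)
      = ∑ S ∈ (Finset.univ : Finset (Fin n)).powerset, g S := by
  rw [Finset.sum_powerset, Finset.card_univ, Fintype.card_fin, Finset.sum_range_succ',
    Finset.powersetCard_zero, Finset.sum_singleton, g0, add_zero, ← Fin.sum_univ_eq_sum_range
      (fun j => ∑ S ∈ Finset.powersetCard (j + 1) Finset.univ, g S)]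
  exact Finset.sum_congr rfl fun p _ =>
    sum_shuffles (k := n - (p.val + 1)) (by omega) g

/-- A shuffle is increasing on each block, so its inversions are exactly the pairs with the larger
value in the first block and the smaller one in the second. -/
theorem koszulSign_shuffle {n i : ℕ} {σ : Equiv.Perm (Fin n)} (hσ : σ ∈ shuffles i n)
    (e : Fin n → ℤ) :
    koszulSign σ e = unshuffleSign e (firstBlock i σ) (Finset.univ \ firstBlock i σ) := by
  obtain ⟨-, hl, hr⟩ := Finset.mem_filter.1 hσ
  rw [unshuffleSign, Finset.prod_sigma', koszulSign]
  refine Finset.prod_nbij' (fun p => ⟨σ p.1, σ p.2⟩) (fun q => (σ.symm q.1, σ.symm q.2))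
    ?_ ?_ ?_ ?_ ?_
  · rintro ⟨a, b⟩ hp
    obtain ⟨hab, hba⟩ := (Finset.mem_filter.1 hp).2
    simp only [firstBlock, Finset.mem_sigma, Finset.mem_filter, Finset.mem_sdiff,
      Finset.mem_univ, true_and, Equiv.symm_apply_apply, not_lt]
    refine ⟨?_, ?_, hba⟩
    · by_contra ha
      exact (hr a b hab (not_lt.1 ha)).not_gt hba
    · by_contra hb
      exact (hl a b hab (not_le.1 hb)).not_gt hba
  · rintro ⟨q, p⟩ hq
    simp only [firstBlock, Finset.mem_sigma, Finset.mem_filter, Finset.mem_sdiff,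
      Finset.mem_univ, true_and, not_lt] at hq ⊢
    simp only [Equiv.apply_symm_apply, Fin.lt_def]
    exact ⟨lt_of_lt_of_le hq.1 hq.2.1, hq.2.2⟩
  · rintro ⟨a, b⟩ _; simp
  · rintro ⟨q, p⟩ _; simp
  · rintro ⟨a, b⟩ _; rfl

theorem suspensionSign_cons {k : ℕ} (c : ℤ) (d : Fin k → ℤ) :
    suspensionSign (Fin.cons (α := fun _ => ℤ) c d)
      = ((k : ℤ) * c).negOnePow * suspensionSign d := by
  rw [suspensionSign, suspensionSign, Fin.sum_univ_succ, Int.negOnePow_add]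
  congr 2
  refine Finset.sum_congr rfl fun b _ => ?_
  rw [Fin.cons_succ, Fin.val_succ]
  congr 2
  omega

/-- Each weight `n - 1 - a` in the first block exceeds the block's own weight `i - 1 - a` by `k`. -/
theorem suspensionSign_append {n i k : ℕ} (h : i + k = n) (d : Fin n → ℤ) :
    suspensionSign d = ((k : ℤ) * ∑ a : Fin i, d ⟨a.val, by omega⟩).negOnePow *
      suspensionSign (fun a : Fin i => d ⟨a.val, by omega⟩) *
      suspensionSign (fun b : Fin k => d ⟨i + b.val, by omega⟩) := by
  subst h
  rw [suspensionSign, suspensionSign, suspensionSign, Fin.sum_univ_add, Finset.mul_sum,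
    ← Int.negOnePow_add, ← Finset.sum_add_distrib, ← Int.negOnePow_add]
  congr 2
  · refine Finset.sum_congr rfl fun a _ => ?_
    have h1 : ((i + k - 1 - a.val : ℕ) : ℤ) = (k : ℤ) + ((i - 1 - a.val : ℕ) : ℤ) := by
      have := a.isLt; omega
    rw [Fin.val_castAdd, h1, add_mul]
    rfl
  · refine Finset.sum_congr rfl fun b _ => ?_
    have h1 : i + k - 1 - (i + b.val) = k - 1 - b.val := by omega
    rw [Fin.val_natAdd, h1]
    rfl

/-- The complete sign of one Jacobi term: the outer suspension sees the inner bracket as one element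
of degree `∑ d + 2 - i`. -/
theorem skewKoszulSign_mul_suspensionSign_cons {n i k : ℕ} (h : i + k = n)
    (σ : Equiv.Perm (Fin n)) (d : Fin n → ℤ) :
    skewKoszulSign σ d * (-1) ^ (i * k) *
      (suspensionSign (Fin.cons (α := fun _ => ℤ)
          ((∑ a : Fin i, d (σ ⟨a.val, by omega⟩)) + (2 - (i : ℤ)))
          (fun b : Fin k => d (σ ⟨i + b.val, by omega⟩))) *
        suspensionSign (fun a : Fin i => d (σ ⟨a.val, by omega⟩)))
      = suspensionSign d * koszulSign σ fun a => d a - 1 := by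
  have h1 := skewKoszulSign_mul_suspensionSign σ d
  have h2 := suspensionSign_append h fun a => d (σ a)
  -- The factor `(-1)^{i(j-1)}`, with `j - 1 = k`, cancels the contribution of the inner bracket's
  -- degree `2 - i`.
  have h3 : ∀ c : ℤ, (-1 : ℤˣ) ^ (i * k) * ((k : ℤ) * (c + (2 - (i : ℤ)))).negOnePow
      = ((k : ℤ) * c).negOnePow := fun c => by
    rw [← zpow_natCast, ← Int.negOnePow_def, ← Int.negOnePow_add]
    exact Int.negOnePow_eq_of_even_sub ⟨k, by push_cast; ring⟩
  have h4 : skewKoszulSign σ d * suspensionSign (fun a => d (σ a))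
      = suspensionSign d * koszulSign σ fun a => d a - 1 := by
    calc _ = skewKoszulSign σ d * suspensionSign d *
          (suspensionSign d * suspensionSign fun a => d (σ a)) := by
          rw [mul_assoc, ← mul_assoc (suspensionSign d), Int.units_mul_self, one_mul]
      _ = suspensionSign d * koszulSign σ (fun a => d a - 1) *
          (suspensionSign (fun a => d (σ a)) * suspensionSign fun a => d (σ a)) := by
          rw [h1]; ac_rfl
      _ = _ := by rw [Int.units_mul_self, mul_one]
  rw [← h4, h2, ← h3 (∑ a : Fin i, d (σ ⟨a.val, by omega⟩)), suspensionSign_cons]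
  ac_rfl

end Shuffles

/-! ### The derived brackets on the suspension and the main theorem. -/

namespace VData

variable {𝕜 L : Type*} [Field 𝕜] [AddCommGroup L] [Module 𝕜 L]
  {ℒ : ℤ → Submodule 𝕜 L} [DirectSum.Decomposition ℒ]
  {G : GradedLieStructure ℒ} {F : VFrame G} (D D' : VData F)

theorem iteratedBracket_eq_nestedBracket {n : ℕ} (a : Fin n → L) :
    D.iteratedBracket n a = G.nestedBracket D.Δ (List.ofFn a) := by
  induction n with
  | zero => simp [iteratedBracket_zero, GradedLieStructure.nestedBracket]
  | succ n ih =>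
    rw [iteratedBracket_succ, ih, List.ofFn_succ', List.concat_eq_append,
      GradedLieStructure.nestedBracket_append_singleton]

theorem iteratedBracket_mem {n : ℕ} (e : Fin n → ℤ) (a : Fin n → L) (ha : ∀ i, a i ∈ ℒ (e i)) :
    D.iteratedBracket n a ∈ ℒ (1 + ∑ i, e i) := by
  induction n with
  | zero => simpa [iteratedBracket_zero] using D.Δ_degree
  | succ n ih =>
    rw [iteratedBracket_succ, Fin.sum_univ_castSucc, ← add_assoc]
    exact G.degree _ _ _ _ (ih (fun i => e i.castSucc) _ fun i => ha _) (ha _)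

theorem derivedBracket_mem {n : ℕ} (e : Fin n → ℤ) (a : Fin n → F.𝔞)
    (ha : ∀ i, a i ∈ F.grading (e i)) : D.derivedBracket n a ∈ F.grading (1 + ∑ i, e i) :=
  F.P_degree _ _ (D.iteratedBracket_mem e (fun i => (a i : L)) ha)

/-- If the swapped entries are the last two, the derivation rule and their commutation suffice.
Otherwise the last bracket is untouched and induction applies. -/
theorem iteratedBracket_swap {n : ℕ} (i : Fin n) (e : Fin (n + 1) → ℤ) (a : Fin (n + 1) → L)
    (ha : ∀ i, a i ∈ ℒ (e i)) (hc : ∀ i j, G.bracket (a i) (a j) = 0) :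
    D.iteratedBracket (n + 1) (fun j => a (Equiv.swap i.castSucc i.succ j))
      = (e i.castSucc * e i.succ).negOnePow • D.iteratedBracket (n + 1) a := by
  induction n with
  | zero => exact i.elim0
  | succ n ih =>
    induction i using Fin.lastCases with
    | last =>
      have h0 : ∀ j : Fin n, Equiv.swap (Fin.last n).castSucc (Fin.last n).succ
          j.castSucc.castSucc = j.castSucc.castSucc := fun j =>
        Equiv.swap_apply_of_ne_of_ne
          (by simp [Fin.ext_iff]; omega) (by simp [Fin.ext_iff]; omega)
      have h1 : Fin.last (n + 1) = (Fin.last n).succ := rfl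
      rw [iteratedBracket_succ, iteratedBracket_succ, iteratedBracket_succ,
        iteratedBracket_succ]
      simp only [h0, h1, Equiv.swap_apply_left, Equiv.swap_apply_right]
      rw [G.bracket_right_comm (D.iteratedBracket_mem (fun j => e j.castSucc.castSucc)
        (fun j => a j.castSucc.castSucc) fun j => ha _) (ha _) (ha _) (hc _ _), mul_comm]
    | cast i =>
      have h0 : ∀ j : Fin (n + 1), Equiv.swap i.castSucc.castSucc i.castSucc.succ j.castSucc
          = (Equiv.swap i.castSucc i.succ j).castSucc := fun j =>
        ((Fin.castSuccEmb (n := n + 1)).injective.swap_apply i.castSucc i.succ j)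
      have h1 : Equiv.swap i.castSucc.castSucc i.castSucc.succ (Fin.last (n + 1))
          = Fin.last (n + 1) :=
        Equiv.swap_apply_of_ne_of_ne
          (by simp [Fin.ext_iff]; omega) (by simp [Fin.ext_iff]; omega)
      rw [D.iteratedBracket_succ (n + 1), D.iteratedBracket_succ (n + 1)]
      simp only [h0, h1]
      rw [ih i (fun j => e j.castSucc) (fun j => a j.castSucc) (fun j => ha _)
        fun j k => hc _ _, G.bracket_units_smul_left]
      rfl

theorem derivedBracket_perm {n : ℕ} (σ : Equiv.Perm (Fin n)) (e : Fin n → ℤ)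
    (a : Fin n → F.𝔞) (ha : ∀ i, a i ∈ F.grading (e i)) :
    D.derivedBracket n (fun i => a (σ i)) = koszulSign σ e • D.derivedBracket n a := by
  induction σ using perm_fin_induction with
  | one n => simp [koszulSign_one]
  | mul σ τ hσ hτ =>
    have := hτ (fun i => e (σ i)) (fun i => a (σ i)) fun i => ha _
    simp only [Equiv.Perm.mul_apply]
    rw [this, hσ e a ha, smul_smul, koszulSign_mul]
  | swap i =>
    apply F.𝔞.subtype_injective
    rw [map_intUnits_smul, koszulSign_swap]
    simp only [Submodule.subtype_apply, derivedBracket_coe]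
    rw [← map_intUnits_smul F.P, ← D.iteratedBracket_swap i e (fun j => (a j : L)) ha
      fun j k => F.abelian _ (a j).2 _ (a k).2]

theorem lInfinityBracket_apply {n : ℕ} (d : Fin n → ℤ) (x : Fin n → F.𝔞)
    (hx : ∀ a, x a ∈ suspension F.grading (d a)) :
    D.lInfinityBracket n x = suspensionSign d • D.derivedBracket n x :=
  suspendFamily_apply F.grading D.derivedBracket n d x hx

theorem lInfinityBracket_mem {n : ℕ} (d : Fin n → ℤ) (x : Fin n → F.𝔞)
    (hx : ∀ a, x a ∈ suspension F.grading (d a)) :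
    D.lInfinityBracket n x ∈ suspension F.grading ((∑ a, d a) + (2 - (n : ℤ))) := by
  rw [D.lInfinityBracket_apply d x hx, Units.smul_def]
  refine zsmul_mem ?_ _
  -- `hx` serves unchanged, since degree `d a` in the suspension is by definition degree `d a - 1`
  -- in `𝔞`.
  have h := D.derivedBracket_mem (fun a => d a - 1) x hx
  have hs : (1 + ∑ a, (d a - 1)) = (∑ a, d a) + (2 - (n : ℤ)) - 1 := by
    simp only [Finset.sum_sub_distrib, Finset.sum_const, Finset.card_univ, Fintype.card_fin,
      nsmul_eq_mul, mul_one]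
    ring
  rwa [hs] at h

theorem lInfinityBracket_perm {n : ℕ} (σ : Equiv.Perm (Fin n)) (d : Fin n → ℤ)
    (x : Fin n → F.𝔞) (hx : ∀ a, x a ∈ suspension F.grading (d a)) :
    D.lInfinityBracket n (fun a => x (σ a)) = skewKoszulSign σ d • D.lInfinityBracket n x := by
  rw [D.lInfinityBracket_apply (fun a => d (σ a)) (fun a => x (σ a)) fun a => hx _,
    D.lInfinityBracket_apply d x hx,
    D.derivedBracket_perm σ (fun a => d a - 1) x hx, smul_smul, smul_smul,
    skewKoszulSign_mul_suspensionSign, mul_comm]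

theorem derivedBracket_cons_units_smul {k : ℕ} (c : ℤˣ) (u : F.𝔞) (v : Fin k → F.𝔞) :
    D.derivedBracket (k + 1) (Fin.cons (α := fun _ => F.𝔞) (c • u) v)
      = c • D.derivedBracket (k + 1) (Fin.cons (α := fun _ => F.𝔞) u v) := by
  rw [Units.smul_def, Units.smul_def, ← Int.cast_smul_eq_zsmul 𝕜, ← Int.cast_smul_eq_zsmul 𝕜]
  exact MultilinearMap.cons_smul _ _ _ _

theorem lInfinityBracket_cons {i k : ℕ} (d : Fin i → ℤ) (d' : Fin k → ℤ) (x : Fin i → F.𝔞)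
    (x' : Fin k → F.𝔞) (hx : ∀ a, x a ∈ suspension F.grading (d a))
    (hx' : ∀ a, x' a ∈ suspension F.grading (d' a)) :
    D.lInfinityBracket (k + 1) (Fin.cons (α := fun _ => F.𝔞) (D'.lInfinityBracket i x) x')
      = (suspensionSign (Fin.cons (α := fun _ => ℤ) ((∑ a, d a) + (2 - (i : ℤ))) d')
          * suspensionSign d) •
        D.derivedBracket (k + 1) (Fin.cons (α := fun _ => F.𝔞) (D'.derivedBracket i x) x') := by
  rw [D.lInfinityBracket_apply (Fin.cons (α := fun _ => ℤ) ((∑ a, d a) + (2 - (i : ℤ))) d') _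
    (Fin.cases (D'.lInfinityBracket_mem d x hx) hx'), D'.lInfinityBracket_apply d x hx,
    derivedBracket_cons_units_smul, smul_smul]

/-- The summand of the higher Jacobi sum at a shuffle, in terms of its first block. -/
theorem lInfinityBracket_shuffle {n i k : ℕ} (h : i + k = n) {σ : Equiv.Perm (Fin n)}
    (hσ : σ ∈ shuffles i n) (d : Fin n → ℤ) (x : Fin n → F.𝔞)
    (hx : ∀ a, x a ∈ suspension F.grading (d a)) :
    (((skewKoszulSign σ d * (-1) ^ (i * k)) •
      D.lInfinityBracket (k + 1) (Fin.cons (α := fun _ => F.𝔞)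
        (D'.lInfinityBracket i fun a => x (σ ⟨a.val, by omega⟩))
        (fun b : Fin k => x (σ ⟨i + b.val, by omega⟩))) : F.𝔞) : L)
      = suspensionSign d •
        (unshuffleSign (fun a => d a - 1) (firstBlock i σ) (Finset.univ \ firstBlock i σ) •
          F.P (G.finsetBracket (fun a => (x a : L))
            (G.bracket D.Δ
              (F.P (G.finsetBracket (fun a => (x a : L)) D'.Δ (firstBlock i σ))))
            (Finset.univ \ firstBlock i σ))) := by
  have h3 : ((D'.derivedBracket i (fun a => x (σ ⟨a.val, by omega⟩)) : F.𝔞) : L)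
      = F.P (G.finsetBracket (fun a => (x a : L)) D'.Δ (firstBlock i σ)) := by
    rw [derivedBracket_coe, iteratedBracket_eq_nestedBracket, GradedLieStructure.finsetBracket,
      ← ofFn_firstBlock h hσ, List.map_ofFn]
    rfl
  have h4 : ∀ u : F.𝔞, ((D.derivedBracket (k + 1) (Fin.cons (α := fun _ => F.𝔞) u
        (fun b : Fin k => x (σ ⟨i + b.val, by omega⟩))) : F.𝔞) : L)
      = F.P (G.finsetBracket (fun a => (x a : L)) (G.bracket D.Δ u)
          (Finset.univ \ firstBlock i σ)) := fun u => by
    rw [derivedBracket_coe, iteratedBracket_eq_nestedBracket, GradedLieStructure.finsetBracket,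
      ← ofFn_firstBlock_compl h hσ, List.map_ofFn, List.ofFn_succ,
      GradedLieStructure.nestedBracket_cons]
    rfl
  have h5 := D.lInfinityBracket_cons D' (fun a : Fin i => d (σ ⟨a.val, by omega⟩))
    (fun b : Fin k => d (σ ⟨i + b.val, by omega⟩)) (fun a => x (σ ⟨a.val, by omega⟩))
    (fun b => x (σ ⟨i + b.val, by omega⟩)) (fun a => hx _) (fun b => hx _)
  rw [h5, smul_smul, skewKoszulSign_mul_suspensionSign_cons h, ← smul_smul,
    ← koszulSign_shuffle hσ, ← h3, ← h4]
  rfl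

theorem higherJacobiSum_lInfinityBracket {n : ℕ} (d : Fin n → ℤ) (x : Fin n → F.𝔞)
    (hx : ∀ a, x a ∈ suspension F.grading (d a)) :
    ((higherJacobiSum D.lInfinityBracket D'.lInfinityBracket n d x : F.𝔞) : L)
      = suspensionSign d • ∑ S ∈ (Finset.univ : Finset (Fin n)).powerset,
        unshuffleSign (fun a => d a - 1) S (Finset.univ \ S) •
          F.P (G.finsetBracket (fun a => (x a : L))
            (G.bracket D.Δ (F.P (G.finsetBracket (fun a => (x a : L)) D'.Δ S)))
            (Finset.univ \ S)) := by
  rw [← sum_sum_shuffles, Finset.smul_sum, higherJacobiSum, ← Submodule.subtype_apply, map_sum]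
  · refine Finset.sum_congr rfl fun p _ => ?_
    rw [map_sum, Finset.smul_sum]
    exact Finset.sum_congr rfl fun σ hσ =>
      D.lInfinityBracket_shuffle D' (by omega) hσ d x hx
  -- The empty subset would be a term with `i = 0`. It vanishes because `D'.Δ` lies in the kernel of
  -- `P`.
  · rw [GradedLieStructure.finsetBracket_empty, LinearMap.mem_ker.1 D'.Δ_mem_ker, map_zero,
      GradedLieStructure.finsetBracket_zero, map_zero, smul_zero]

theorem higherJacobiSum_add_higherJacobiSum (h : G.bracket D.Δ D'.Δ = 0) {n : ℕ}
    (d : Fin n → ℤ) (x : Fin n → F.𝔞) (hx : ∀ a, x a ∈ suspension F.grading (d a)) :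
    higherJacobiSum D.lInfinityBracket D'.lInfinityBracket n d x
      + higherJacobiSum D'.lInfinityBracket D.lInfinityBracket n d x = 0 := by
  apply F.𝔞.subtype_injective
  rw [map_add, map_zero, Submodule.subtype_apply, Submodule.subtype_apply,
    higherJacobiSum_lInfinityBracket D D' d x hx, higherJacobiSum_lInfinityBracket D' D d x hx,
    ← smul_add, F.sum_powerset_derived (y := fun a => (x a : L)) (e := fun a => d a - 1)
      hx (fun a => (x a).2) D.Δ_degree D'.Δ_degree h, smul_zero]

theorem isLInfinityAlgebra [CharZero 𝕜] :
    IsLInfinityAlgebra (suspension F.grading) D.lInfinityBracket where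
  degree _ _ d x hx := D.lInfinityBracket_mem d x hx
  skew_symm _ _ σ d x hx := D.lInfinityBracket_perm σ d x hx
  jacobi n _ d x hx := by
    -- With both data equal, the mixed identity is twice the Jacobi sum.
    have h := D.higherJacobiSum_add_higherJacobiSum D D.Δ_square_zero d x hx
    rw [← two_smul 𝕜] at h
    exact (smul_eq_zero.1 h).resolve_left two_ne_zero

end VData

theorem mainTheorem8 {𝕜 L : Type*} [Field 𝕜] [CharZero 𝕜] [AddCommGroup L] [Module 𝕜 L]
    (ℒ : ℤ → Submodule 𝕜 L) [DirectSum.Decomposition ℒ] (G : GradedLieStructure ℒ)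
    (F : VFrame G) (D D' : VData F) (h : D.Compatible D') :
    IsCompatibleLInfinityAlgebra (suspension F.grading)
      D.lInfinityBracket D'.lInfinityBracket where
  left := D.isLInfinityAlgebra
  right := D'.isLInfinityAlgebra
  compatible _ _ d x hx := D.higherJacobiSum_add_higherJacobiSum D' h d x hx
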